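/- Let $a,b,c\in\mathbb{R}$ and $\sigma>0$. Let $\epsilon=\{\epsilon_{i,j}\}_{i,j\in\mathbb{Z}}$ be uncorrelated real random variables with mean $0$ and variance $\sigma^2$, and let $X=\{X_{i,j}\}_{i,j\in\mathbb{Z}}$ be a real wide-sense stationary random field on the same probability space (finite second moments, constant mean, and $\gamma_X(h_1,h_2)=\operatorname{cov}(X_{i,j},X_{i-h_1,j-h_2})$ independent of $i,j$) such that, almost surely for all $i,j\in\mathbb{Z}$, $$X_{i,j}=aX_{i-1,j}+bX_{i,j-1}+cX_{i-1,j-1}+\epsilon_{i,j}.$$ Put $$D=(1-a-b-c)(1-a+b+c)(1+a-b+c)(1+a+b-c).$$ Then $D>0$, the denominators in $$\alpha=\frac{2(a+bc)}{1+a^2-b^2-c^2+\operatorname{sign}(1+a^2-b^2-c^2)\sqrt{D}},\qquad \beta=\frac{2(ac+b)}{1-a^2+b^2-c^2+\operatorname{sign}(1-a^2+b^2-c^2)\sqrt{D}}$$ are nonzero, and for all $h_1,h_2\in\mathbb{Z}$ (with the convention $0^0=1$) $$\gamma_X(0,h_2)=\frac{\beta^{|h_2|}\sigma^2}{\sqrt{D}},\qquad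 \gamma_X(h_1,0)=\frac{\alpha^{|h_1|}\sigma^2}{\sqrt{D}}.$$ In particular $\operatorname{Var}X_{i,j}=\gamma_X(0,0)=\sigma^2/\sqrt{D}$ for all $i,j\in\mathbb{Z}$. Moreover $|\alpha|<1$ and $|\beta|<1$, so that $|\gamma_X(1,0)|<\gamma_X(0,0)$ and $|\gamma_X(0,1)|<\gamma_X(0,0)$. -/

import Mathlib

namespace PlanarAR

open MeasureTheory ProbabilityTheory

noncomputable section

/-- The autocovariance function `γ_X(h₁, h₂)` of a real random field on `ℤ²`, read off at the
origin; for a wide-sense stationary field the base point is irrelevant. -/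
def autocov {Ω : Type*} [MeasurableSpace Ω] (μ : Measure Ω) (X : ℤ → ℤ → Ω → ℝ)
    (h₁ h₂ : ℤ) : ℝ :=
  cov[X 0 0, X (-h₁) (-h₂); μ]

/-- Wide-sense stationarity: finite second moments, constant mean, and a covariance of
`X_{i,j}` and `X_{i-h₁,j-h₂}` that does not depend on `(i, j)`. -/
structure IsWideSenseStationary {Ω : Type*} [MeasurableSpace Ω] (μ : Measure Ω)
    (X : ℤ → ℤ → Ω → ℝ) : Prop where
  memLp : ∀ i j, MemLp (X i j) 2 μ
  mean_eq : ∀ i j, ∫ ω, X i j ω ∂μ = ∫ ω, X 0 0 ω ∂μ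
  cov_eq : ∀ i j h₁ h₂, cov[X i j, X (i - h₁) (j - h₂); μ] = autocov μ X h₁ h₂

/-- Uncorrelated random variables with zero mean and equal variance `σ ^ 2`. -/
structure IsWhiteNoise {Ω : Type*} [MeasurableSpace Ω] (μ : Measure Ω)
    (ε : ℤ → ℤ → Ω → ℝ) (σ : ℝ) : Prop where
  memLp : ∀ i j, MemLp (ε i j) 2 μ
  mean_zero : ∀ i j, ∫ ω, ε i j ω ∂μ = 0
  variance_eq : ∀ i j, Var[ε i j; μ] = σ ^ 2
  uncorrelated : ∀ i j k l, (i, j) ≠ (k, l) → cov[ε i j, ε k l; μ] = 0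

/-- The first-order planar autoregressive equation (almost surely, at every lattice point). -/
def SolvesAR {Ω : Type*} [MeasurableSpace Ω] (μ : Measure Ω) (a b c : ℝ)
    (X ε : ℤ → ℤ → Ω → ℝ) : Prop :=
  ∀ i j, ∀ᵐ ω ∂μ,
    X i j ω = a * X (i - 1) j ω + b * X i (j - 1) ω + c * X (i - 1) (j - 1) ω + ε i j ω

/-- The discriminant `D`. -/
def D (a b c : ℝ) : ℝ :=
  (1 - a - b - c) * (1 - a + b + c) * (1 + a - b + c) * (1 + a + b - c)

/-- The denominator of `α`. -/
def alphaDenom (a b c : ℝ) : ℝ :=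
  1 + a ^ 2 - b ^ 2 - c ^ 2 + Real.sign (1 + a ^ 2 - b ^ 2 - c ^ 2) * √(D a b c)

/-- The denominator of `β`. -/
def betaDenom (a b c : ℝ) : ℝ :=
  1 - a ^ 2 + b ^ 2 - c ^ 2 + Real.sign (1 - a ^ 2 + b ^ 2 - c ^ 2) * √(D a b c)

def alpha (a b c : ℝ) : ℝ := 2 * (a + b * c) / alphaDenom a b c

def beta (a b c : ℝ) : ℝ := 2 * (a * c + b) / betaDenom a b c

end

end PlanarAR

/-! Centre the field and view it in complex `L²`. For |z| = 1, the Fourier sum S_j of row j over a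
window of length N satisfies (1 - az) S_j = (b + cz) S_{j-1} + noise + boundary, with a boundary
term bounded independently of N. Stationarity makes ‖S_j‖ independent of j, so the recursion can be
iterated in whichever direction contracts, and no causality is needed. Put q(θ) = |1 - az|² - |b +
cz|² = s - 2t cos θ, where s = 1 + a² - b² - c² and t = a + bc. Where q ≠ 0, ‖S_j‖ = σ√N/√|q| + O(1)
(`IsHilbertAR.abs_freqSum_sub_le`), so the periodogram ‖S_0‖²/N tends to σ²/|q|.

The periodogram has integral 2πγ(0,0), so Fatou's lemma makes σ²/|q| integrable. An isolated zero of
q would be a non-integrable pole, and q ≡ 0 is excluded by a separate growth estimate; hence 2|t| <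
|s| (`IsHilbertAR.two_mul_abs_lt`), that is, D = s² - 4t² > 0. Dominated convergence now identifies
γ(m,0) with the Fourier coefficients of σ²/|q|. Multiplying by q yields a second-order recurrence
with a source at 0 (`IsHilbertAR.row_recurrence`), whose bounded solution is geometric with ratio α
(`eq_root_pow_of_recurrence`). Exchanging the coordinates gives β. -/

namespace PlanarAR

open Complex Finset Filter Topology MeasureTheory

/-! ### Vector recursions with orthogonal innovations -/

section HilbertAR

variable {H : Type*} [NormedAddCommGroup H] [InnerProductSpace ℂ H]

/-- Pythagoras for linear combinations of orthogonal vectors of equal norm. -/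
lemma norm_sq_sum_smul_of_orthogonal {ι : Type*} [DecidableEq ι] {v : ι → H} {τ : ℝ}
    (horth : ∀ i j, i ≠ j → inner ℂ (v i) (v j) = 0) (hnorm : ∀ i, ‖v i‖ = τ)
    (w : ι → ℂ) (s : Finset ι) :
    ‖∑ i ∈ s, w i • v i‖ ^ 2 = τ ^ 2 * ∑ i ∈ s, ‖w i‖ ^ 2 := by
  induction s using Finset.induction_on with
  | empty => simp
  | insert i s hi ih =>
    have h0 : inner ℂ (w i • v i) (∑ j ∈ s, w j • v j) = 0 := by
      rw [inner_sum]
      refine Finset.sum_eq_zero fun j hj => ?_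
      have : i ≠ j := fun h => hi (h ▸ hj)
      simp [inner_smul_left, inner_smul_right, horth i j this]
    rw [Finset.sum_insert hi, Finset.sum_insert hi, @norm_add_sq ℂ, h0, ih, norm_smul, hnorm]
    simp
    ring

/-- A finite iteration of the recursion `A S k = B S (k + 1) + U k`. -/
lemma smul_eq_iterate {A B : ℂ} (hA : A ≠ 0) {S U : ℕ → H}
    (hrec : ∀ k, A • S k = B • S (k + 1) + U k) (n : ℕ) :
    A • S 0 = (A * (B / A) ^ n) • S n + ∑ k ∈ range n, (B / A) ^ k • U k := by
  induction n with
  | zero => simp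
  | succ n ih =>
    have h : (A * (B / A) ^ n) • S n
        = (A * (B / A) ^ (n + 1)) • S (n + 1) + (B / A) ^ n • U n := by
      rw [mul_comm, mul_smul, hrec, smul_add, smul_smul]
      congr 2
      rw [pow_succ]
      field_simp
    rw [ih, h, Finset.sum_range_succ]
    abel

variable {A B : ℂ} {S E R : ℕ → H} {M τ K : ℝ}

/-- The finite iteration plus the reverse triangle inequality. No size condition on B / A is
imposed, so that both the contracting and the critical case can use it. -/
lemma abs_norm_sub_norm_sum_le (hA : A ≠ 0)
    (hrec : ∀ k, A • S k = B • S (k + 1) + (E k + R k)) (hS : ∀ k, ‖S k‖ = M)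
    (hR : ∀ k, ‖R k‖ ≤ K) (n : ℕ) :
    |‖A‖ * M - ‖∑ k ∈ range n, (B / A) ^ k • E k‖|
      ≤ ‖A‖ * ‖B / A‖ ^ n * M + K * ∑ k ∈ range n, ‖B / A‖ ^ k := by
  have h := smul_eq_iterate hA hrec n
  have h2 : A • S 0 - ∑ k ∈ range n, (B / A) ^ k • E k
      = (A * (B / A) ^ n) • S n + ∑ k ∈ range n, (B / A) ^ k • R k := by
    rw [h]; simp only [smul_add, Finset.sum_add_distrib]; abel
  calc _ = |‖A • S 0‖ - ‖∑ k ∈ range n, (B / A) ^ k • E k‖| := by rw [norm_smul, hS]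
    _ ≤ _ := abs_norm_sub_norm_le _ _
    _ ≤ ‖(A * (B / A) ^ n) • S n‖ + ‖∑ k ∈ range n, (B / A) ^ k • R k‖ := by
      rw [h2]; exact norm_add_le _ _
    _ ≤ _ := by
      gcongr
      · rw [norm_smul, norm_mul, norm_pow, hS]
      · rw [Finset.mul_sum]
        refine (norm_sum_le _ _).trans (Finset.sum_le_sum fun k _ => ?_)
        rw [norm_smul, norm_pow, mul_comm]
        gcongr
        exact hR k

/-- The norm of a bounded solution of a strictly contracting recursion with orthogonal
innovations and bounded perturbations. -/
lemma abs_norm_sub_le_of_norm_lt (hAB : ‖B‖ < ‖A‖)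
    (hrec : ∀ k, A • S k = B • S (k + 1) + (E k + R k)) (hS : ∀ k, ‖S k‖ = M)
    (horth : ∀ k l, k ≠ l → inner ℂ (E k) (E l) = 0) (hE : ∀ k, ‖E k‖ = τ)
    (hR : ∀ k, ‖R k‖ ≤ K) :
    |M - τ / √(‖A‖ ^ 2 - ‖B‖ ^ 2)| ≤ K / (‖A‖ - ‖B‖) := by
  have hA0 : 0 < ‖A‖ := (norm_nonneg B).trans_lt hAB
  have hA : A ≠ 0 := norm_pos_iff.mp hA0
  have hτ : 0 ≤ τ := hE 0 ▸ norm_nonneg _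
  set r := ‖B / A‖ with hr
  have hr' : r = ‖B‖ / ‖A‖ := norm_div _ _
  have hr0 : 0 ≤ r := norm_nonneg _
  have hr1 : r < 1 := by rw [hr', div_lt_one hA0]; exact hAB
  have hr2 : r ^ 2 < 1 := by nlinarith
  have hsum : ∀ n, ‖∑ k ∈ range n, (B / A) ^ k • E k‖
      = √(τ ^ 2 * ∑ k ∈ range n, (r ^ 2) ^ k) := by
    intro n
    rw [← Real.sqrt_sq (norm_nonneg (∑ k ∈ range n, (B / A) ^ k • E k)),
      norm_sq_sum_smul_of_orthogonal horth hE]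
    congr 2
    refine Finset.sum_congr rfl fun k _ => ?_
    rw [norm_pow, ← hr]; ring
  have hlim1 : Tendsto (fun n => |‖A‖ * M - ‖∑ k ∈ range n, (B / A) ^ k • E k‖|) atTop
      (𝓝 |‖A‖ * M - √(τ ^ 2 * (1 - r ^ 2)⁻¹)|) := by
    simp only [hsum]
    refine (tendsto_const_nhds.sub (Real.continuous_sqrt.continuousAt.tendsto.comp ?_)).abs
    exact ((hasSum_geometric_of_lt_one (by positivity) hr2).tendsto_sum_nat).const_mul _
  have hlim2 : Tendsto (fun n => ‖A‖ * r ^ n * M + K * ∑ k ∈ range n, r ^ k) atTop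
      (𝓝 (‖A‖ * 0 * M + K * (1 - r)⁻¹)) := by
    refine Tendsto.add ?_ ?_
    · exact ((tendsto_pow_atTop_nhds_zero_of_lt_one hr0 hr1).const_mul _).mul_const _
    · exact ((hasSum_geometric_of_lt_one hr0 hr1).tendsto_sum_nat).const_mul _
  have key := le_of_tendsto_of_tendsto' hlim1 hlim2
    (fun n => abs_norm_sub_norm_sum_le hA hrec hS hR n)
  have e1 : √(τ ^ 2 * (1 - r ^ 2)⁻¹) = ‖A‖ * (τ / √(‖A‖ ^ 2 - ‖B‖ ^ 2)) := by
    have h3 : ‖A‖ ^ 2 - ‖B‖ ^ 2 = ‖A‖ ^ 2 * (1 - r ^ 2) := by rw [hr']; field_simp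
    rw [h3, Real.sqrt_mul (by positivity), Real.sqrt_mul (by positivity), Real.sqrt_sq hτ,
      Real.sqrt_sq hA0.le, Real.sqrt_inv]
    field_simp
  have e2 : K * (1 - r)⁻¹ = ‖A‖ * (K / (‖A‖ - ‖B‖)) := by
    have : ‖A‖ - ‖B‖ = ‖A‖ * (1 - r) := by rw [hr']; field_simp
    rw [this]; field_simp
  rw [e1, e2, ← mul_sub, abs_mul, abs_norm] at key
  have := le_of_mul_le_mul_left (by linarith : ‖A‖ * |M - τ / √(‖A‖ ^ 2 - ‖B‖ ^ 2)| ≤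
    ‖A‖ * (K / (‖A‖ - ‖B‖))) hA0
  exact this

/-- On the critical circle the norm of a solution cannot stay bounded. -/
lemma sqrt_mul_le_of_norm_eq (hAB : ‖B‖ = ‖A‖)
    (hrec : ∀ k, A • S k = B • S (k + 1) + (E k + R k)) (hS : ∀ k, ‖S k‖ = M)
    (horth : ∀ k l, k ≠ l → inner ℂ (E k) (E l) = 0) (hE : ∀ k, ‖E k‖ = τ)
    (hR : ∀ k, ‖R k‖ ≤ K) (n : ℕ) :
    √n * τ ≤ 2 * ‖A‖ * M + n * K := by
  have hτ : 0 ≤ τ := hE 0 ▸ norm_nonneg _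
  have hK : 0 ≤ K := (norm_nonneg _).trans (hR 0)
  by_cases hA : A = 0
  -- Degenerate case: the recursion reads E + R = 0, so τ ≤ K, and √n ≤ n suffices.
  · have hB : B = 0 := by simpa [hA] using hAB
    have h := hrec 0
    have h1 : τ ≤ K := by
      have : E 0 = - R 0 := by
        rw [eq_neg_iff_add_eq_zero]; simpa [hA, hB] using h.symm
      rw [← hE 0, this, norm_neg]; exact hR 0
    have h2 : √(n : ℝ) ≤ n := by
      rw [Real.sqrt_le_left (by positivity)]
      exact_mod_cast Nat.le_self_pow two_ne_zero n
    simpa [hA] using mul_le_mul h2 h1 hτ (by positivity)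
  · have hr : ‖B / A‖ = 1 := by rw [norm_div, hAB, div_self (norm_ne_zero_iff.mpr hA)]
    have h := abs_norm_sub_norm_sum_le hA hrec hS hR n
    have h1 : ‖∑ k ∈ range n, (B / A) ^ k • E k‖ = √n * τ := by
      rw [← Real.sqrt_sq (norm_nonneg (∑ k ∈ range n, (B / A) ^ k • E k)),
        norm_sq_sum_smul_of_orthogonal horth hE]
      simp only [norm_pow, hr, one_pow, sum_const, card_range, nsmul_eq_mul, mul_one]
      rw [Real.sqrt_mul (by positivity), Real.sqrt_sq hτ, mul_comm]
    rw [h1, hr] at h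
    simp only [one_pow, mul_one, sum_const, card_range, nsmul_eq_mul] at h
    linarith [neg_abs_le (‖A‖ * M - √n * τ)]

end HilbertAR

end PlanarAR

/-! ### Windowed Fourier sums of the rows -/

namespace PlanarAR

open Complex Finset Filter Topology MeasureTheory

section HilbertField

variable {H : Type*} [NormedAddCommGroup H] [InnerProductSpace ℂ H]

/-- A stationary planar autoregression inside a complex inner product space. -/
structure IsHilbertAR (a b c σ : ℝ) (x e : ℤ → ℤ → H) (γ : ℤ → ℤ → ℝ) : Prop where
  inner_eq : ∀ i j k l, inner ℂ (x i j) (x k l) = (γ (i - k) (j - l) : ℂ)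
  eq : ∀ i j, x i j = (a : ℂ) • x (i - 1) j + (b : ℂ) • x i (j - 1)
    + (c : ℂ) • x (i - 1) (j - 1) + e i j
  orthogonal : ∀ p q : ℤ × ℤ, p ≠ q → inner ℂ (e p.1 p.2) (e q.1 q.2) = 0
  norm_eq : ∀ i j, ‖e i j‖ = σ

/-- The windowed Fourier sum of a sequence of vectors. -/
def freqSum (z : ℂ) (N : ℕ) (y : ℤ → H) : H := ∑ i ∈ range N, z ^ i • y i

/-- A shift acts as multiplication by z up to two end vectors, whatever the window length; this
keeps the perturbation bounded as N grows. -/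
lemma freqSum_shift (z : ℂ) (N : ℕ) (y : ℤ → H) :
    freqSum z N (fun i => y (i - 1))
      = z • freqSum z N y + (y (-1) - z ^ N • y (N - 1)) := by
  induction N with
  | zero => simp [freqSum]
  | succ N ih =>
    simp only [freqSum] at ih ⊢
    rw [Finset.sum_range_succ, Finset.sum_range_succ, ih, smul_add, smul_smul, ← pow_succ']
    push_cast
    rw [add_sub_cancel_right]
    abel

lemma freqSum_exp_norm_sq {y : ℤ → H} {g : ℤ → ℝ}
    (h : ∀ i k, inner ℂ (y i) (y k) = (g (i - k) : ℂ)) (N : ℕ) (θ : ℝ) :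
    ‖freqSum (exp (θ * I)) N y‖ ^ 2
      = ∑ i ∈ range N, ∑ k ∈ range N, g ((i : ℤ) - k) * Real.cos (((i : ℤ) - k : ℤ) * θ) := by
  rw [← inner_self_eq_norm_sq (𝕜 := ℂ), freqSum, sum_inner, map_sum]
  refine Finset.sum_congr rfl fun i _ => ?_
  rw [inner_sum, map_sum]
  refine Finset.sum_congr rfl fun k _ => ?_
  rw [inner_smul_left, inner_smul_right, h, ← Complex.exp_nat_mul, ← Complex.exp_nat_mul,
    ← Complex.exp_conj, ← mul_assoc, ← Complex.exp_add]
  have e1 : (starRingEnd ℂ) (i * (θ * I)) + k * (θ * I)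
      = ((-((((i : ℤ) - k : ℤ) : ℝ) * θ) : ℝ) : ℂ) * I := by
    simp
    ring
  rw [e1]
  change (_ : ℂ).re = _
  rw [Complex.re_mul_ofReal, Complex.exp_ofReal_mul_I_re, Real.cos_neg, mul_comm]

variable {a b c σ : ℝ} {x e : ℤ → ℤ → H} {γ : ℤ → ℤ → ℝ}

lemma IsHilbertAR.norm_sq_eq (h : IsHilbertAR a b c σ x e γ) (i j : ℤ) :
    ‖x i j‖ ^ 2 = γ 0 0 := by
  have h1 := h.inner_eq i j i j
  rw [inner_self_eq_norm_sq_to_K, sub_self, sub_self] at h1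
  apply Complex.ofReal_injective
  rw [← h1]
  push_cast
  rfl

lemma IsHilbertAR.abs_autocov_le (h : IsHilbertAR a b c σ x e γ) (i j : ℤ) : |γ i j| ≤ γ 0 0 := by
  have h1 := norm_inner_le_norm (𝕜 := ℂ) (x i j) (x 0 0)
  rw [h.inner_eq, sub_zero, sub_zero, Complex.norm_real, Real.norm_eq_abs] at h1
  have h2 := h.norm_sq_eq i j
  have h3 := h.norm_sq_eq 0 0
  nlinarith [sq_nonneg (‖x i j‖ - ‖x 0 0‖)]

lemma IsHilbertAR.neg (h : IsHilbertAR a b c σ x e γ) (i j : ℤ) : γ (-i) (-j) = γ i j := by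
  have h1 := h.inner_eq 0 0 i j
  rw [← inner_conj_symm, h.inner_eq] at h1
  simpa using h1.symm

/-- The symbol `|1 - a z|² - |b + c z|²` on the unit circle. -/
noncomputable def symb (a b c θ : ℝ) : ℝ :=
  1 + a ^ 2 - b ^ 2 - c ^ 2 - 2 * (a + b * c) * Real.cos θ

lemma norm_sq_sub_norm_sq (a b c θ : ℝ) :
    ‖1 - (a : ℂ) * exp (θ * I)‖ ^ 2 - ‖(b : ℂ) + c * exp (θ * I)‖ ^ 2 = symb a b c θ := by
  rw [Complex.sq_norm, Complex.sq_norm, Complex.normSq_apply, Complex.normSq_apply]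
  simp [Complex.exp_ofReal_mul_I_re, Complex.exp_ofReal_mul_I_im, symb]
  have := Real.sin_sq_add_cos_sq θ
  linear_combination (a ^ 2 - c ^ 2) * this

/-- Size bound for the boundary terms. -/
noncomputable def bdry (a c v : ℝ) : ℝ := 2 * (|a| + |c|) * √v

/-- Size bound for the symbol factors. -/
noncomputable def coefBound (a b c : ℝ) : ℝ := 1 + |a| + |b| + |c|

lemma IsHilbertAR.freqSum_eq (h : IsHilbertAR a b c σ x e γ) (z : ℂ) (hz : ‖z‖ = 1) (N : ℕ)
    (j : ℤ) : ∃ R : H, ‖R‖ ≤ bdry a c (γ 0 0) ∧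
      (1 - a * z) • freqSum z N (fun i => x i j)
        = (b + c * z) • freqSum z N (fun i => x i (j - 1))
          + (freqSum z N (fun i => e i j) + R) := by
  have hx : ∀ i j, ‖x i j‖ = √(γ 0 0) := fun i j => by
    rw [← h.norm_sq_eq i j, Real.sqrt_sq (norm_nonneg _)]
  have hb : ∀ j, ‖x (-1) j - z ^ N • x (N - 1) j‖ ≤ 2 * √(γ 0 0) := fun j => by
    refine (norm_sub_le _ _).trans ?_
    rw [norm_smul, norm_pow, hz, hx, hx]
    simp [two_mul]
  -- The end vectors of the two horizontally shifted terms, those with coefficients a and c.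
  refine ⟨(a : ℂ) • (x (-1) j - z ^ N • x (N - 1) j)
    + (c : ℂ) • (x (-1) (j - 1) - z ^ N • x (N - 1) (j - 1)), ?_, ?_⟩
  · refine (norm_add_le _ _).trans ?_
    rw [norm_smul, norm_smul, Complex.norm_real, Complex.norm_real, Real.norm_eq_abs,
      Real.norm_eq_abs, bdry]
    nlinarith [mul_le_mul_of_nonneg_left (hb j) (abs_nonneg a),
      mul_le_mul_of_nonneg_left (hb (j - 1)) (abs_nonneg c)]
  · have h1 : freqSum z N (fun i => x i j)
        = (a : ℂ) • freqSum z N (fun i => x (i - 1) j)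
          + (b : ℂ) • freqSum z N (fun i => x i (j - 1))
          + (c : ℂ) • freqSum z N (fun i => x (i - 1) (j - 1))
          + freqSum z N (fun i => e i j) := by
      simp only [freqSum, Finset.smul_sum, ← Finset.sum_add_distrib]
      refine Finset.sum_congr rfl fun i _ => ?_
      rw [h.eq i j]
      simp only [smul_add, smul_comm (z ^ i)]
    rw [freqSum_shift z N (fun i => x i j), freqSum_shift z N (fun i => x i (j - 1))] at h1
    rw [sub_smul, one_smul]
    nth_rewrite 1 [h1]
    module

lemma IsHilbertAR.freqSum_noise_norm (h : IsHilbertAR a b c σ x e γ) {z : ℂ} (hz : ‖z‖ = 1)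
    (N : ℕ) (j : ℤ) : ‖freqSum z N (fun i => e i j)‖ = σ * √N := by
  have hσ : 0 ≤ σ := h.norm_eq 0 0 ▸ norm_nonneg _
  rw [← Real.sqrt_sq (norm_nonneg (freqSum _ _ _)), freqSum,
    norm_sq_sum_smul_of_orthogonal (v := fun i : ℕ => e i j) (τ := σ)
      (fun i k hik => h.orthogonal (i, j) (k, j) (by simpa using hik)) (fun i => h.norm_eq _ _)]
  simp [hz, Real.sqrt_mul (sq_nonneg σ), Real.sqrt_sq hσ]

lemma IsHilbertAR.freqSum_noise_orthogonal (h : IsHilbertAR a b c σ x e γ) (z : ℂ)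
    (N : ℕ) {j k : ℤ} (hjk : j ≠ k) :
    inner ℂ (freqSum z N (fun i => e i j)) (freqSum z N (fun i => e i k)) = 0 := by
  rw [freqSum, freqSum, sum_inner]
  refine Finset.sum_eq_zero fun i _ => ?_
  rw [inner_sum]
  refine Finset.sum_eq_zero fun l _ => ?_
  rw [inner_smul_left, inner_smul_right,
    h.orthogonal (i, j) (l, k) (fun h => hjk (congrArg Prod.snd h))]
  simp

/-- The squared norm expands into covariances within one row, which by stationarity do not see j. -/
lemma IsHilbertAR.freqSum_norm_const (h : IsHilbertAR a b c σ x e γ) (N : ℕ) (θ : ℝ) (j : ℤ) :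
    ‖freqSum (exp (θ * I)) N (fun i => x i j)‖ = ‖freqSum (exp (θ * I)) N (fun i => x i 0)‖ := by
  have h1 : ∀ j, ‖freqSum (exp (θ * I)) N (fun i => x i j)‖ ^ 2 = _ := fun j =>
    freqSum_exp_norm_sq (y := fun i => x i j) (g := fun m => γ m 0)
      (fun i k => by simp [h.inner_eq]) N θ
  rw [← sq_eq_sq₀ (norm_nonneg _) (norm_nonneg _), h1, h1]

lemma norm_one_sub_le (a b c θ : ℝ) :
    ‖1 - (a : ℂ) * exp (θ * I)‖ + ‖(b : ℂ) + c * exp (θ * I)‖ ≤ coefBound a b c := by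
  have h1 := norm_sub_le 1 ((a : ℂ) * exp (θ * I))
  have h2 := norm_add_le (b : ℂ) (c * exp (θ * I))
  simp [Complex.norm_exp_ofReal_mul_I] at h1 h2
  rw [coefBound]
  linarith

/-- Away from the zeros of the symbol, the windowed Fourier sums have the expected size. -/
lemma IsHilbertAR.abs_freqSum_sub_le (h : IsHilbertAR a b c σ x e γ) (N : ℕ) {θ : ℝ}
    (hq : symb a b c θ ≠ 0) :
    |‖freqSum (exp (θ * I)) N (fun i => x i 0)‖ - σ * √N / √(|symb a b c θ|)|
      ≤ bdry a c (γ 0 0) * coefBound a b c / |symb a b c θ| := by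
  set z := exp (θ * I) with hz
  have hz1 : ‖z‖ = 1 := Complex.norm_exp_ofReal_mul_I θ
  have hqe := norm_sq_sub_norm_sq a b c θ
  have hL := norm_one_sub_le a b c θ
  rw [← hz] at hqe hL
  set A := 1 - (a : ℂ) * z with hA
  set B := (b : ℂ) + c * z with hB
  choose R hRn hR using h.freqSum_eq z hz1 N
  have hK : 0 ≤ bdry a c (γ 0 0) := (norm_nonneg _).trans (hRn 0)
  -- Rewrites 1/(v - u) as (v + u)/(v² - u²), so that the error is expressed through the symbol.
  have hfrac : ∀ u v : ℝ, 0 ≤ u → u < v → v + u ≤ coefBound a b c →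
      bdry a c (γ 0 0) / (v - u) ≤ bdry a c (γ 0 0) * coefBound a b c / (v ^ 2 - u ^ 2) := by
    intro u v hu huv hc
    have h1 : 0 < v - u := sub_pos.2 huv
    have h2 : 0 < v + u := by linarith
    have h3 : v ^ 2 - u ^ 2 = (v - u) * (v + u) := by ring
    rw [h3, div_le_div_iff₀ h1 (by positivity)]
    have := mul_le_mul_of_nonneg_left hc (mul_nonneg hK h1.le)
    linarith
  rcases lt_trichotomy ‖B‖ ‖A‖ with hlt | heq | hlt
  · have hpos : 0 < symb a b c θ := by rw [← hqe]; nlinarith [norm_nonneg B]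
    -- Contraction towards the past: step k of the recursion is row -k.
    rw [abs_of_pos hpos, ← hqe]
    refine (abs_norm_sub_le_of_norm_lt (S := fun k : ℕ => freqSum z N (fun i => x i (-k)))
      (E := fun k : ℕ => freqSum z N (fun i => e i (-k))) (R := fun k : ℕ => R (-k)) hlt
      (fun k => ?_) (fun k => h.freqSum_norm_const N θ _)
      (fun k l hkl => h.freqSum_noise_orthogonal z N (by simpa using hkl))
      (fun k => h.freqSum_noise_norm hz1 N _) (fun k => hRn _)).trans
      (hfrac _ _ (norm_nonneg _) hlt hL)
    have := hR (-k)
    rw [this]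
    push_cast
    rw [neg_add, ← sub_eq_add_neg]
  · exact absurd (by rw [← hqe, heq, sub_self]) hq
  · have hneg : symb a b c θ < 0 := by rw [← hqe]; nlinarith [norm_nonneg A]
    -- Contraction towards the future: the equation of row k + 1 is solved for row k, so A and B
    -- trade places and noise and remainder change sign.
    rw [abs_of_neg hneg, ← hqe, neg_sub]
    refine (abs_norm_sub_le_of_norm_lt (S := fun k : ℕ => freqSum z N (fun i => x i k))
      (E := fun k : ℕ => -freqSum z N (fun i => e i (k + 1))) (R := fun k : ℕ => -R (k + 1)) hlt
      (fun k => ?_) (fun k => h.freqSum_norm_const N θ _)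
      (fun k l hkl => ?_)
      (fun k => by rw [norm_neg]; exact h.freqSum_noise_norm hz1 N _)
      (fun k => by rw [norm_neg]; exact hRn _)).trans
      (hfrac _ _ (norm_nonneg _) hlt (by linarith))
    · have := hR (k + 1)
      push_cast
      rw [this, add_sub_cancel_right]
      abel
    · rw [inner_neg_neg]
      exact h.freqSum_noise_orthogonal z N (by simpa using hkl)

lemma IsHilbertAR.sqrt_mul_le (h : IsHilbertAR a b c σ x e γ) (N n : ℕ) {θ : ℝ}
    (hq : symb a b c θ = 0) :
    √n * (σ * √N) ≤ 2 * coefBound a b c * ‖freqSum (exp (θ * I)) N (fun i => x i 0)‖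
      + n * bdry a c (γ 0 0) := by
  set z := exp (θ * I) with hz
  have hz1 : ‖z‖ = 1 := Complex.norm_exp_ofReal_mul_I θ
  have hqe := norm_sq_sub_norm_sq a b c θ
  have hL := norm_one_sub_le a b c θ
  rw [← hz] at hqe hL
  choose R hRn hR using h.freqSum_eq z hz1 N
  have heq : ‖(b : ℂ) + c * z‖ = ‖1 - (a : ℂ) * z‖ := by
    rw [← sq_eq_sq₀ (norm_nonneg _) (norm_nonneg _)]
    linarith
  refine (sqrt_mul_le_of_norm_eq (S := fun k : ℕ => freqSum z N (fun i => x i (-k)))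
      (E := fun k : ℕ => freqSum z N (fun i => e i (-k))) (R := fun k : ℕ => R (-k)) heq
      (fun k => ?_) (fun k => h.freqSum_norm_const N θ _)
      (fun k l hkl => h.freqSum_noise_orthogonal z N (by simpa using hkl))
      (fun k => h.freqSum_noise_norm hz1 N _) (fun k => hRn _) n).trans ?_
  · have := hR (-k)
    rw [this]
    push_cast
    rw [neg_add, ← sub_eq_add_neg]
  · gcongr
    linarith [norm_nonneg ((b : ℂ) + c * z)]

end HilbertField

end PlanarAR

/-! ### Cosine orthogonality -/

namespace PlanarAR

open Complex Finset Filter Topology MeasureTheory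

lemma integral_cos_int_mul (n : ℤ) :
    ∫ θ in (0 : ℝ)..(2 * Real.pi), Real.cos (n * θ) = if n = 0 then 2 * Real.pi else 0 := by
  split_ifs with hn
  · simp [hn]
  · have hn' : (n : ℝ) ≠ 0 := by exact_mod_cast hn
    rw [intervalIntegral.integral_comp_mul_left (fun y => Real.cos y) hn', integral_cos]
    have : Real.sin (n * (2 * Real.pi)) = 0 := by
      have := Real.sin_int_mul_pi (2 * n)
      push_cast at this
      rw [← this]; ring_nf
    simp [this]

lemma integral_cos_mul_cos (n m : ℤ) :
    ∫ θ in (0 : ℝ)..(2 * Real.pi), Real.cos (n * θ) * Real.cos (m * θ)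
      = Real.pi * ((if n = m then 1 else 0) + if m = -n then 1 else 0) := by
  have h : ∀ θ : ℝ, Real.cos (n * θ) * Real.cos (m * θ)
      = (1 / 2) * (Real.cos ((n - m : ℤ) * θ) + Real.cos ((m + n : ℤ) * θ)) := by
    intro θ
    push_cast
    rw [sub_mul, add_mul, Real.cos_sub, Real.cos_add]
    ring
  simp only [h]
  rw [intervalIntegral.integral_const_mul, intervalIntegral.integral_add
    (Continuous.intervalIntegrable (by fun_prop) _ _)
    (Continuous.intervalIntegrable (by fun_prop) _ _), integral_cos_int_mul,
    integral_cos_int_mul]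
  simp only [sub_eq_zero, add_eq_zero_iff_eq_neg]
  split_ifs <;> ring

lemma sum_range_sum_range_diag (u : ℝ) {N m : ℕ} (hm : m ≤ N) :
    ∑ i ∈ range N, ∑ k ∈ range N, (if (i : ℤ) - k = m then u else 0) = (N - m) * u := by
  have h : ∀ k ∈ range N, ∑ i ∈ range N, (if (i : ℤ) - k = m then u else 0)
      = if k < N - m then u else 0 := by
    intro k _
    have : ∀ i : ℕ, ((i : ℤ) - k = m) ↔ i = k + m := fun i => by omega
    simp only [this, Finset.sum_ite_eq', Finset.mem_range]
    congr 1
    exact propext (by omega)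
  rw [Finset.sum_comm, Finset.sum_congr rfl h, ← Finset.sum_filter, Finset.sum_const]
  have : (range N).filter (fun k => k < N - m) = range (N - m) := by
    ext k; simp; omega
  rw [this, Finset.card_range, nsmul_eq_mul, Nat.cast_sub hm]

/-! ### The periodogram and the zeros of the symbol -/

section Periodogram

variable {H : Type*} [NormedAddCommGroup H] [InnerProductSpace ℂ H]

/-- The periodogram of the row `j = 0`. -/
noncomputable def pgram (x : ℤ → ℤ → H) (N : ℕ) (θ : ℝ) : ℝ :=
  ‖freqSum (exp (θ * I)) N (fun i => x i 0)‖ ^ 2 / N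

lemma pgram_nonneg (x : ℤ → ℤ → H) (N : ℕ) (θ : ℝ) : 0 ≤ pgram x N θ := by
  unfold pgram; positivity

lemma continuous_pgram (x : ℤ → ℤ → H) (N : ℕ) : Continuous (pgram x N) := by
  unfold pgram freqSum; fun_prop

variable {a b c σ : ℝ} {x e : ℤ → ℤ → H} {γ : ℤ → ℤ → ℝ}

/-- The factor 1 - m/N is the Fejér weight: N - m pairs in the window are at lag m. -/
lemma IsHilbertAR.integral_pgram_mul_cos (h : IsHilbertAR a b c σ x e γ) {N m : ℕ}
    (hN : 0 < N) (hm : m ≤ N) :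
    ∫ θ in (0 : ℝ)..(2 * Real.pi), pgram x N θ * Real.cos ((m : ℤ) * θ)
      = 2 * Real.pi * (1 - m / N) * γ m 0 := by
  have hN' : (N : ℝ) ≠ 0 := by positivity
  have h1 : ∀ θ : ℝ, pgram x N θ * Real.cos ((m : ℤ) * θ)
      = (1 / N) * ∑ i ∈ range N, ∑ k ∈ range N, γ ((i : ℤ) - k) 0 *
        (Real.cos (((i : ℤ) - k : ℤ) * θ) * Real.cos ((m : ℤ) * θ)) := by
    intro θ
    rw [pgram, freqSum_exp_norm_sq (g := fun m => γ m 0)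
      (fun i k => by simp [h.inner_eq]) N θ, div_mul_eq_mul_div, Finset.sum_mul,
      div_eq_inv_mul, one_div]
    congr 1
    refine Finset.sum_congr rfl fun i _ => ?_
    rw [Finset.sum_mul]
    exact Finset.sum_congr rfl fun k _ => by ring
  simp only [h1]
  rw [intervalIntegral.integral_const_mul, intervalIntegral.integral_finsetSum
    (fun i _ => Continuous.intervalIntegrable (by fun_prop) _ _)]
  -- The diagonals i - k = m and k - i = m contribute π each; for m = 0 they coincide and give 2π.
  have h2 : ∀ i ∈ range N, ∫ θ in (0 : ℝ)..(2 * Real.pi), ∑ k ∈ range N, γ ((i : ℤ) - k) 0 *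
        (Real.cos (((i : ℤ) - k : ℤ) * θ) * Real.cos ((m : ℤ) * θ))
      = ∑ k ∈ range N, ((if (i : ℤ) - k = m then Real.pi * γ m 0 else 0)
        + (if (k : ℤ) - i = m then Real.pi * γ m 0 else 0)) := by
    intro i _
    rw [intervalIntegral.integral_finsetSum
      (fun i _ => Continuous.intervalIntegrable (by fun_prop) _ _)]
    refine Finset.sum_congr rfl fun k _ => ?_
    rw [intervalIntegral.integral_const_mul, integral_cos_mul_cos]
    have e1 : ((m : ℤ) = -((i : ℤ) - k)) ↔ (k : ℤ) - i = m := by omega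
    have e2 : (k : ℤ) - i = m → γ ((i : ℤ) - k) 0 = γ m 0 := fun hk => by
      rw [← h.neg, ← hk]; simp
    have e3 : (i : ℤ) - k = m → γ ((i : ℤ) - k) 0 = γ m 0 := fun hk => by rw [hk]
    simp only [e1]
    split_ifs with c1 c2 c2
    · rw [e3 c1]; ring
    · rw [e3 c1]; ring
    · rw [e2 c2]; ring
    · ring
  rw [Finset.sum_congr rfl h2]
  simp only [Finset.sum_add_distrib]
  rw [sum_range_sum_range_diag _ hm, Finset.sum_comm, sum_range_sum_range_diag _ hm]
  field_simp
  ring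

lemma IsHilbertAR.abs_sqrt_pgram_sub_le (h : IsHilbertAR a b c σ x e γ) {N : ℕ} (hN : 0 < N)
    {θ : ℝ} (hq : symb a b c θ ≠ 0) :
    |√(pgram x N θ) - σ / √(|symb a b c θ|)|
      ≤ bdry a c (γ 0 0) * coefBound a b c / |symb a b c θ| / √N := by
  have hN' : 0 < √(N : ℝ) := by positivity
  have h1 := h.abs_freqSum_sub_le N hq
  rw [le_div_iff₀ hN']
  refine le_trans (le_of_eq ?_) h1
  rw [pgram, Real.sqrt_div (sq_nonneg _), Real.sqrt_sq (norm_nonneg _)]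
  nth_rewrite 2 [← abs_of_pos hN']
  rw [← abs_mul, sub_mul, div_mul_cancel₀ _ hN'.ne', div_mul_eq_mul_div]

lemma IsHilbertAR.tendsto_pgram (h : IsHilbertAR a b c σ x e γ)
    {θ : ℝ} (hq : symb a b c θ ≠ 0) :
    Tendsto (fun N => pgram x N θ) atTop (𝓝 (σ ^ 2 / |symb a b c θ|)) := by
  have h1 : Tendsto (fun N => √(pgram x N θ)) atTop (𝓝 (σ / √(|symb a b c θ|))) := by
    rw [tendsto_iff_norm_sub_tendsto_zero]
    have h2 : Tendsto (fun N : ℕ => bdry a c (γ 0 0) * coefBound a b c / |symb a b c θ| / √N)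
        atTop (𝓝 0) :=
      tendsto_const_nhds.div_atTop (Real.tendsto_sqrt_atTop.comp tendsto_natCast_atTop_atTop)
    refine squeeze_zero' (Eventually.of_forall fun _ => norm_nonneg _) ?_ h2
    filter_upwards [eventually_gt_atTop 0] with N hN using h.abs_sqrt_pgram_sub_le hN hq
  have h2 := h1.pow 2
  simpa only [Real.sq_sqrt (pgram_nonneg _ _ _), div_pow, Real.sq_sqrt (abs_nonneg _)] using h2

lemma IsHilbertAR.integral_pgram (h : IsHilbertAR a b c σ x e γ) {N : ℕ} (hN : 0 < N) :
    ∫ θ in (0 : ℝ)..(2 * Real.pi), pgram x N θ = 2 * Real.pi * γ 0 0 := by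
  simpa using h.integral_pgram_mul_cos (m := 0) hN (Nat.zero_le _)

lemma continuous_symb (a b c : ℝ) : Continuous (symb a b c) := by
  unfold symb; fun_prop

/-- The spectral density of the row is integrable (Fatou). -/
lemma IsHilbertAR.intervalIntegrable (h : IsHilbertAR a b c σ x e γ) :
    IntervalIntegrable (fun θ => σ ^ 2 / |symb a b c θ|) volume 0 (2 * Real.pi) := by
  have hpi : (0 : ℝ) ≤ 2 * Real.pi := by positivity
  rw [intervalIntegrable_iff_integrableOn_Ioc_of_le hpi]
  have hmeas : Measurable (fun θ => σ ^ 2 / |symb a b c θ|) :=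
    measurable_const.div (continuous_symb a b c).abs.measurable
  refine ⟨hmeas.aestronglyMeasurable, ?_⟩
  rw [hasFiniteIntegral_iff_ofReal (Eventually.of_forall fun θ => by positivity)]
  have hint : ∀ N : ℕ, 0 < N → ∫⁻ θ in Set.Ioc 0 (2 * Real.pi), ENNReal.ofReal (pgram x N θ)
      = ENNReal.ofReal (2 * Real.pi * γ 0 0) := by
    intro N hN
    rw [← h.integral_pgram hN, intervalIntegral.integral_of_le hpi,
      ofReal_integral_eq_lintegral_ofReal]
    · exact ((continuous_pgram x N).intervalIntegrable _ _).1
    · exact Eventually.of_forall fun θ => pgram_nonneg _ _ _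
  calc _ ≤ ∫⁻ θ in Set.Ioc 0 (2 * Real.pi),
        liminf (fun N => ENNReal.ofReal (pgram x N θ)) atTop := by
        refine lintegral_mono fun θ => ?_
        -- At a zero of the symbol the quotient is 0 by convention, so no limit is needed there.
        by_cases hq : symb a b c θ = 0
        · simp [hq]
        · exact ((ENNReal.tendsto_ofReal (h.tendsto_pgram hq)).liminf_eq).ge
    _ ≤ liminf (fun N => ∫⁻ θ in Set.Ioc 0 (2 * Real.pi), ENNReal.ofReal (pgram x N θ)) atTop :=
        lintegral_liminf_le fun N => (continuous_pgram x N).measurable.ennreal_ofReal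
    _ = ENNReal.ofReal (2 * Real.pi * γ 0 0) := by
        refine Tendsto.liminf_eq (tendsto_const_nhds.congr' ?_)
        filter_upwards [eventually_gt_atTop 0] with N hN using (hint N hN).symm
    _ < ⊤ := ENNReal.ofReal_lt_top

/-- If the symbol vanished identically, the critical growth estimate would push the periodogram
above γ(0,0) + 1 at every frequency, contradicting its mean γ(0,0). -/
lemma IsHilbertAR.exists_symb_ne_zero (h : IsHilbertAR a b c σ x e γ) (hσ : 0 < σ) :
    ∃ θ, symb a b c θ ≠ 0 := by
  by_contra! hq
  set L := coefBound a b c with hL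
  set K := bdry a c (γ 0 0) with hK
  have hL0 : 0 < L := by rw [hL, coefBound]; positivity
  -- The number n of iterated rows is fixed first; the window N is then taken so long that the
  -- accumulated boundary error n * K is at most √N.
  obtain ⟨n, hn⟩ : ∃ n : ℕ, 2 * L * (√(γ 0 0) + 1) + 1 ≤ √(n : ℝ) * σ :=
    (((Real.tendsto_sqrt_atTop.comp tendsto_natCast_atTop_atTop).atTop_mul_const
      hσ).eventually_ge_atTop _).exists
  obtain ⟨N, hN, hN0⟩ : ∃ N : ℕ, n * K ≤ √(N : ℝ) ∧ 0 < N :=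
    (((Real.tendsto_sqrt_atTop.comp tendsto_natCast_atTop_atTop).eventually_ge_atTop
      (n * K)).and (eventually_gt_atTop 0)).exists
  have hNs : 0 < √(N : ℝ) := by positivity
  have hγ : 0 ≤ γ 0 0 := (abs_nonneg _).trans (h.abs_autocov_le 0 0)
  have hlow : ∀ θ, γ 0 0 + 1 ≤ pgram x N θ := by
    intro θ
    have h1 := h.sqrt_mul_le N n (hq θ)
    rw [← hL, ← hK] at h1
    set M := ‖freqSum (exp (θ * I)) N (fun i => x i 0)‖ with hM
    have h2 : (2 * L * (√(γ 0 0) + 1) + 1) * √(N : ℝ) ≤ 2 * L * M + √(N : ℝ) := by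
      nlinarith [mul_le_mul_of_nonneg_right hn hNs.le]
    have h3 : (√(γ 0 0) + 1) * √(N : ℝ) ≤ M := by
      have : (2 * L) * ((√(γ 0 0) + 1) * √(N : ℝ)) ≤ (2 * L) * M := by linarith
      exact le_of_mul_le_mul_left this (by positivity)
    have h4 := pow_le_pow_left₀ (by positivity) h3 2
    rw [mul_pow, Real.sq_sqrt (Nat.cast_nonneg N)] at h4
    rw [pgram, ← hM, le_div_iff₀ (by exact_mod_cast hN0)]
    refine le_trans ?_ h4
    gcongr
    nlinarith [Real.sq_sqrt hγ, Real.sqrt_nonneg (γ 0 0)]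
  have h5 := intervalIntegral.integral_mono (μ := volume) (a := 0) (b := 2 * Real.pi)
    (by positivity) (continuous_const.intervalIntegrable _ _)
    ((continuous_pgram x N).intervalIntegrable _ _) hlow
  rw [h.integral_pgram hN0, intervalIntegral.integral_const, smul_eq_mul] at h5
  nlinarith [Real.pi_pos]

/-- Stationarity forces the symbol to have no zeros on the circle. -/
lemma IsHilbertAR.two_mul_abs_lt (h : IsHilbertAR a b c σ x e γ) (hσ : 0 < σ) :
    2 * |a + b * c| < |1 + a ^ 2 - b ^ 2 - c ^ 2| := by
  by_contra! hle
  have ht : a + b * c ≠ 0 := by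
    intro ht
    obtain ⟨θ, hθ⟩ := h.exists_symb_ne_zero hσ
    rw [ht] at hle
    have : 1 + a ^ 2 - b ^ 2 - c ^ 2 = 0 := by simpa using hle
    exact hθ (by simp [symb, ht, this])
  set t := a + b * c with htd
  set s := 1 + a ^ 2 - b ^ 2 - c ^ 2 with hsd
  have hc : |s / (2 * t)| ≤ 1 := by
    rw [abs_div, abs_mul, abs_two, div_le_one (by positivity)]
    exact hle
  set θ₀ := Real.arccos (s / (2 * t)) with hθ₀
  have hz : symb a b c θ₀ = 0 := by
    rw [symb, hθ₀, Real.cos_arccos (neg_le_of_abs_le hc) (le_of_abs_le hc), ← htd, ← hsd]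
    field_simp
    ring
  have hmem : θ₀ ∈ Set.uIcc 0 (2 * Real.pi) := by
    rw [Set.uIcc_of_le (by positivity)]
    exact ⟨Real.arccos_nonneg _, (Real.arccos_le_pi _).trans (by linarith [Real.pi_pos])⟩
  have han : AnalyticOnNhd ℝ (symb a b c) Set.univ := by
    intro θ _
    unfold symb
    fun_prop
  have hne : ∀ᶠ θ in 𝓝[≠] θ₀, symb a b c θ ≠ 0 := by
    refine ((han θ₀ trivial).eventually_eq_zero_or_eventually_ne_zero).resolve_left fun h0 => ?_
    -- By analyticity the symbol would vanish everywhere; its values s - 2t at 0 and s + 2t at π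
    -- then force t = 0.
    have hall := han.eqOn_zero_of_preconnected_of_eventuallyEq_zero isPreconnected_univ trivial h0
    have h1 := hall (Set.mem_univ 0)
    have h2 := hall (Set.mem_univ Real.pi)
    simp only [symb, Real.cos_zero, Real.cos_pi, Pi.zero_apply] at h1 h2
    exact ht (by rw [htd]; linarith)
  -- A zero of order at least one makes the reciprocal dominate 1/(θ - θ₀), which is not integrable.
  have hO : symb a b c =O[𝓝 θ₀] fun θ => θ - θ₀ := by
    have := (han θ₀ trivial).differentiableAt.isBigO_sub
    simpa [hz] using this
  refine not_intervalIntegrable_of_sub_inv_isBigO_punctured (c := θ₀) ?_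
    (by positivity : (0 : ℝ) ≠ 2 * Real.pi) hmem h.intervalIntegrable
  have h1 : (fun θ => (θ - θ₀)⁻¹) =O[𝓝[≠] θ₀] fun θ => (symb a b c θ)⁻¹ :=
    (hO.mono nhdsWithin_le_nhds).inv_rev (hne.mono fun θ h1 h2 => absurd h2 h1)
  refine h1.trans ?_
  refine Asymptotics.IsBigO.of_bound (1 / σ ^ 2) (Eventually.of_forall fun θ => ?_)
  rw [norm_inv, norm_div, Real.norm_eq_abs, Real.norm_eq_abs, Real.norm_eq_abs, abs_abs,
    abs_of_pos (by positivity : (0 : ℝ) < σ ^ 2)]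
  apply le_of_eq
  field_simp

end Periodogram

end PlanarAR

/-! ### Bounded solutions of the second-order recurrence -/

namespace PlanarAR

open Complex Finset Filter Topology MeasureTheory

lemma D_eq (a b c : ℝ) :
    D a b c = (1 + a ^ 2 - b ^ 2 - c ^ 2) ^ 2 - 4 * (a + b * c) ^ 2 := by
  unfold D; ring

lemma sign_mul_self_eq_abs (s : ℝ) : Real.sign s * s = |s| := by
  rcases lt_trichotomy s 0 with h | h | h
  · rw [Real.sign_of_neg h, abs_of_neg h]; ring
  · simp [h]
  · rw [Real.sign_of_pos h, abs_of_pos h]; ring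

lemma sign_sq {s : ℝ} (hs : s ≠ 0) : Real.sign s ^ 2 = 1 := by
  rcases Real.sign_apply_eq_of_ne_zero s hs with h | h <;> rw [h] <;> norm_num

section Root

variable {s t Δ : ℝ}

lemma abs_add_sign_mul (r : ℝ) (hr : 0 ≤ r) (hs : s ≠ 0) :
    |s + Real.sign s * r| = |s| + r := by
  have h2 := sign_sq hs
  have h3 : s + Real.sign s * r = Real.sign s * (|s| + r) := by
    rw [← sign_mul_self_eq_abs]; linear_combination (-s) * h2
  have h4 : |Real.sign s| = 1 := by
    rcases Real.sign_apply_eq_of_ne_zero s hs with h | h <;> rw [h] <;> norm_num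
  rw [h3, abs_mul, h4, one_mul, abs_of_nonneg (by positivity)]

lemma root_denom_ne_zero (hs : s ≠ 0) : s + Real.sign s * √Δ ≠ 0 := by
  rw [← abs_pos, abs_add_sign_mul _ (Real.sqrt_nonneg _) hs]
  positivity

lemma abs_root_lt_one (hst : 2 * |t| < |s|) : |2 * t / (s + Real.sign s * √Δ)| < 1 := by
  have hs : s ≠ 0 := abs_pos.1 ((by positivity : 0 ≤ 2 * |t|).trans_lt hst)
  rw [abs_div, abs_add_sign_mul _ (Real.sqrt_nonneg _) hs, abs_mul, abs_two,
    div_lt_one (by positivity)]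
  linarith [Real.sqrt_nonneg Δ]

/-- A bounded solution of the second-order recursion is the decaying geometric sequence. -/
lemma eq_root_pow_of_recurrence (hst : 2 * |t| < |s|) (hΔ : Δ = s ^ 2 - 4 * t ^ 2) {v C : ℝ}
    {g : ℕ → ℝ} (hg : ∀ m, |g m| ≤ C) (h0 : s * g 0 - 2 * t * g 1 = Real.sign s * v)
    (hrec : ∀ m, s * g (m + 1) = t * (g (m + 2) + g m)) (m : ℕ) :
    g m = (2 * t / (s + Real.sign s * √Δ)) ^ m * v / √Δ := by
  have hs : s ≠ 0 := abs_pos.1 ((by positivity : 0 ≤ 2 * |t|).trans_lt hst)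
  have hΔ0 : 0 < Δ := by
    have := sq_lt_sq' (by linarith [abs_nonneg t, abs_nonneg s]) hst
    rw [mul_pow, sq_abs, sq_abs] at this
    linarith
  have hα1 := abs_root_lt_one (Δ := Δ) hst
  have hden := root_denom_ne_zero (Δ := Δ) hs
  have hsg := sign_sq hs
  set r := √Δ with hr
  have hr0 : 0 < r := Real.sqrt_pos.2 hΔ0
  have hr2 : r ^ 2 = s ^ 2 - 4 * t ^ 2 := by rw [hr, Real.sq_sqrt hΔ0.le, hΔ]
  set ε := Real.sign s with hε
  set α := 2 * t / (s + ε * r) with hα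
  -- Spectral factorisation: t = αu and s = u(1 + α²), that is, s - 2t cos θ = u |1 - α exp(iθ)|².
  set u := (s + ε * r) / 2 with hu
  have hu0 : u ≠ 0 := div_ne_zero hden two_ne_zero
  have ht : t = α * u := by rw [hα, hu]; field_simp
  have hs' : s = u * (1 + α ^ 2) := by
    have h1 : u * s = u ^ 2 + t ^ 2 := by
      rw [hu]; linear_combination (-1 / 4) * r ^ 2 * hsg + (-1 / 4) * hr2
    have h2 : u * s = u * (u * (1 + α ^ 2)) := by rw [h1, ht]; ring
    exact mul_left_cancel₀ hu0 h2
  -- The factorised recurrence: the defect g(m+1) - αg(m) is α times the next one. Being bounded,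
  -- and |α| < 1, it must vanish.
  have hd : ∀ m, g (m + 1) - α * g m = α * (g (m + 2) - α * g (m + 1)) := by
    intro m
    have h1 := hrec m
    rw [hs', ht] at h1
    have h2 : u * (g (m + 1) - α * g m) = u * (α * (g (m + 2) - α * g (m + 1))) := by
      linear_combination h1
    exact mul_left_cancel₀ hu0 h2
  have hd' : ∀ n m, g (m + 1) - α * g m = α ^ n * (g (m + n + 1) - α * g (m + n)) := by
    intro n
    induction n with
    | zero => intro m; simp
    | succ n ih =>
      intro m
      rw [ih m, hd (m + n)]
      ring_nf
  have hC : 0 ≤ C := (abs_nonneg _).trans (hg 0)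
  have hzero : ∀ m, g (m + 1) = α * g m := by
    intro m
    have hb : ∀ n, |g (m + 1) - α * g m| ≤ |α| ^ n * (2 * C) := by
      intro n
      rw [hd' n m, abs_mul, abs_pow]
      gcongr
      refine (abs_sub _ _).trans ?_
      rw [abs_mul]
      have := mul_le_mul hα1.le (hg (m + n)) (abs_nonneg _) zero_le_one
      linarith [hg (m + n + 1)]
    have hl : Tendsto (fun n => |α| ^ n * (2 * C)) atTop (𝓝 (0 * (2 * C))) :=
      (tendsto_pow_atTop_nhds_zero_of_lt_one (abs_nonneg _) hα1).mul_const _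
    rw [zero_mul] at hl
    have := ge_of_tendsto' hl hb
    exact sub_eq_zero.1 (abs_nonpos_iff.1 this)
  have hpow : ∀ m, g m = α ^ m * g 0 := by
    intro m
    induction m with
    | zero => simp
    | succ n ih => rw [hzero, ih, pow_succ]; ring
  have hg0 : g 0 = v / r := by
    rw [hzero 0] at h0
    have h1 : s - 2 * t * α = ε * r := by
      have : ε * r = 2 * u - s := by rw [hu]; ring
      rw [this, ht, hs']; ring
    have h2 : r * g 0 = v := by
      linear_combination ε * h0 - ε * g 0 * h1 + (v - r * g 0) * hsg
    rw [← h2]; field_simp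
  rw [hpow m, hg0, mul_div_assoc]

end Root

/-! ### Row autocovariances as Fourier coefficients -/

section Periodogram

variable {H : Type*} [NormedAddCommGroup H] [InnerProductSpace ℂ H]
variable {a b c σ : ℝ} {x e : ℤ → ℤ → H} {γ : ℤ → ℤ → ℝ}

lemma sign_mul_symb (hst : 2 * |a + b * c| < |1 + a ^ 2 - b ^ 2 - c ^ 2|) (θ : ℝ) :
    |symb a b c θ| = Real.sign (1 + a ^ 2 - b ^ 2 - c ^ 2) * symb a b c θ ∧
      |1 + a ^ 2 - b ^ 2 - c ^ 2| - 2 * |a + b * c| ≤ |symb a b c θ| := by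
  have h1 : |2 * (a + b * c) * Real.cos θ| ≤ 2 * |a + b * c| := by
    rw [abs_mul, abs_mul, abs_two]
    exact mul_le_of_le_one_right (by positivity) (Real.abs_cos_le_one θ)
  have h2 := abs_le.1 h1
  rw [symb]
  set s := 1 + a ^ 2 - b ^ 2 - c ^ 2
  rcases lt_trichotomy s 0 with h | h | h
  · rw [abs_of_neg h] at *
    rw [Real.sign_of_neg h, abs_of_neg (by linarith)]
    constructor <;> linarith
  · rw [h, abs_zero] at hst
    linarith [abs_nonneg (a + b * c)]
  · rw [abs_of_pos h] at *
    rw [Real.sign_of_pos h, abs_of_pos (by linarith)]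
    constructor <;> linarith

/-- The row autocovariances are the Fourier coefficients of the spectral density. -/
lemma IsHilbertAR.autocov_eq_integral (h : IsHilbertAR a b c σ x e γ) (hσ : 0 < σ) (m : ℕ) :
    2 * Real.pi * γ m 0
      = ∫ θ in (0 : ℝ)..(2 * Real.pi), σ ^ 2 / |symb a b c θ| * Real.cos ((m : ℤ) * θ) := by
  have hst := h.two_mul_abs_lt hσ
  set δ := |1 + a ^ 2 - b ^ 2 - c ^ 2| - 2 * |a + b * c| with hδ
  have hδ0 : 0 < δ := sub_pos.2 hst
  have hlow : ∀ θ, δ ≤ |symb a b c θ| := fun θ => (sign_mul_symb hst θ).2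
  have hne : ∀ θ, symb a b c θ ≠ 0 := fun θ => abs_pos.1 (hδ0.trans_le (hlow θ))
  set P := bdry a c (γ 0 0) * coefBound a b c with hP
  have hP0 : 0 ≤ P := by rw [hP, bdry, coefBound]; positivity
  have hlim1 : Tendsto (fun N : ℕ => ∫ θ in (0 : ℝ)..(2 * Real.pi),
      pgram x N θ * Real.cos ((m : ℤ) * θ)) atTop (𝓝 (2 * Real.pi * γ m 0)) := by
    have h1 : Tendsto (fun N : ℕ => 2 * Real.pi * (1 - (m : ℝ) / N) * γ m 0) atTop
        (𝓝 (2 * Real.pi * (1 - 0) * γ m 0)) :=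
      ((tendsto_const_nhds.sub
        (tendsto_const_nhds.div_atTop tendsto_natCast_atTop_atTop)).const_mul _).mul_const _
    rw [sub_zero, mul_one] at h1
    refine h1.congr' ?_
    filter_upwards [eventually_gt_atTop 0, eventually_ge_atTop m] with N hN hm
    exact (h.integral_pgram_mul_cos hN hm).symm
  have hlim2 : Tendsto (fun N : ℕ => ∫ θ in (0 : ℝ)..(2 * Real.pi),
      pgram x N θ * Real.cos ((m : ℤ) * θ)) atTop
      (𝓝 (∫ θ in (0 : ℝ)..(2 * Real.pi), σ ^ 2 / |symb a b c θ| * Real.cos ((m : ℤ) * θ))) := by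
    -- The constant majorant comes from the square-root estimate, using |symb| ≥ δ and √N ≥ 1.
    refine intervalIntegral.tendsto_integral_filter_of_dominated_convergence
      (fun _ => (σ / √δ + P / δ) ^ 2) ?_ ?_ ?_ ?_
    · refine Eventually.of_forall fun N => Continuous.aestronglyMeasurable ?_
      have := continuous_pgram x N
      fun_prop
    · filter_upwards [eventually_gt_atTop 0] with N hN
      refine Eventually.of_forall fun θ _ => ?_
      rw [norm_mul, Real.norm_eq_abs, Real.norm_eq_abs, abs_of_nonneg (pgram_nonneg _ _ _)]
      refine (mul_le_of_le_one_right (pgram_nonneg _ _ _) (Real.abs_cos_le_one _)).trans ?_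
      have h1 := (abs_le.1 (h.abs_sqrt_pgram_sub_le hN (hne θ))).2
      have h2 : σ / √(|symb a b c θ|) ≤ σ / √δ := by
        gcongr
        exact hlow θ
      have h3 : P / |symb a b c θ| / √N ≤ P / δ := by
        have hN1 : 1 ≤ √(N : ℝ) := by
          rw [Real.one_le_sqrt]; exact_mod_cast hN
        refine (div_le_self (by positivity) hN1).trans ?_
        gcongr
        exact hlow θ
      rw [← Real.sq_sqrt (pgram_nonneg x N θ)]
      gcongr
      linarith
    · exact continuous_const.intervalIntegrable _ _
    · exact Eventually.of_forall fun θ _ => (h.tendsto_pgram (hne θ)).mul_const _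
  exact tendsto_nhds_unique hlim1 hlim2

/-- The symbol has constant sign, so its product with the spectral density is the constant
sign(s)σ², whose only nonzero Fourier coefficient is at 0; multiplication by 2 cos θ becomes the sum
of the two neighbouring lags. -/
lemma IsHilbertAR.row_recurrence (h : IsHilbertAR a b c σ x e γ) (hσ : 0 < σ) (m : ℤ) :
    (1 + a ^ 2 - b ^ 2 - c ^ 2) * γ m 0 - (a + b * c) * (γ (m + 1) 0 + γ (m - 1) 0)
      = if m = 0 then Real.sign (1 + a ^ 2 - b ^ 2 - c ^ 2) * σ ^ 2 else 0 := by
  have hst := h.two_mul_abs_lt hσ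
  have hlow := fun θ => (sign_mul_symb hst θ).2
  have hsgn := fun θ => (sign_mul_symb hst θ).1
  have hpos : ∀ θ, 0 < |symb a b c θ| := fun θ => (sub_pos.2 hst).trans_le (hlow θ)
  have hs : 1 + a ^ 2 - b ^ 2 - c ^ 2 ≠ 0 :=
    abs_pos.1 ((by positivity : 0 ≤ 2 * |a + b * c|).trans_lt hst)
  have hF : ∀ n : ℤ, 2 * Real.pi * γ n 0
      = ∫ θ in (0 : ℝ)..(2 * Real.pi), σ ^ 2 / |symb a b c θ| * Real.cos (n * θ) := by
    intro n
    obtain ⟨k, rfl | rfl⟩ := n.eq_nat_or_neg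
    · exact h.autocov_eq_integral hσ k
    · have := h.neg k 0
      rw [neg_zero] at this
      rw [this, h.autocov_eq_integral hσ k]
      simp
  have hcont : ∀ n : ℤ, IntervalIntegrable
      (fun θ => σ ^ 2 / |symb a b c θ| * Real.cos (n * θ)) volume 0 (2 * Real.pi) := by
    intro n
    refine Continuous.intervalIntegrable ?_ _ _
    exact (continuous_const.div (continuous_symb a b c).abs fun θ => (hpos θ).ne').mul
      (by fun_prop)
  set s := 1 + a ^ 2 - b ^ 2 - c ^ 2 with hsd
  set t := a + b * c with htd
  have h1 : 2 * Real.pi * (s * γ m 0 - t * (γ (m + 1) 0 + γ (m - 1) 0))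
      = ∫ θ in (0 : ℝ)..(2 * Real.pi), Real.sign s * σ ^ 2 * Real.cos (m * θ) := by
    have : 2 * Real.pi * (s * γ m 0 - t * (γ (m + 1) 0 + γ (m - 1) 0))
      = s * (2 * Real.pi * γ m 0)
        - t * (2 * Real.pi * γ (m + 1) 0 + 2 * Real.pi * γ (m - 1) 0) := by ring
    rw [this, hF, hF, hF, ← intervalIntegral.integral_add (hcont _) (hcont _),
      ← intervalIntegral.integral_const_mul, ← intervalIntegral.integral_const_mul,
      ← intervalIntegral.integral_sub ((hcont _).const_mul _)
        (((hcont _).add (hcont _)).const_mul _)]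
    refine intervalIntegral.integral_congr fun θ _ => ?_
    have e1 : Real.cos ((m + 1 : ℤ) * θ) + Real.cos ((m - 1 : ℤ) * θ)
        = 2 * Real.cos θ * Real.cos (m * θ) := by
      push_cast
      rw [add_mul, sub_mul, one_mul, Real.cos_add, Real.cos_sub]; ring
    have e2 : symb a b c θ = s - 2 * t * Real.cos θ := by rw [symb]
    have e3 : symb a b c θ = Real.sign s * |symb a b c θ| := by
      rw [hsgn]; linear_combination (-symb a b c θ) * sign_sq hs
    have e4 : σ ^ 2 / |symb a b c θ| * symb a b c θ = Real.sign s * σ ^ 2 := by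
      have := (hpos θ).ne'
      nth_rewrite 2 [e3]
      field_simp
    calc _ = σ ^ 2 / |symb a b c θ| * (s * Real.cos (m * θ)
          - t * (Real.cos ((m + 1 : ℤ) * θ) + Real.cos ((m - 1 : ℤ) * θ))) := by ring
      _ = σ ^ 2 / |symb a b c θ| * symb a b c θ * Real.cos (m * θ) := by rw [e1, e2]; ring
      _ = _ := by rw [e4]
  rw [intervalIntegral.integral_const_mul, integral_cos_int_mul] at h1
  have hpi := Real.pi_pos
  refine mul_left_cancel₀ (by positivity : 2 * Real.pi ≠ 0) (h1.trans ?_)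
  split_ifs <;> ring

/-- Positivity of the discriminant and the row autocovariances. -/
theorem IsHilbertAR.row_autocov (h : IsHilbertAR a b c σ x e γ) (hσ : 0 < σ) :
    0 < D a b c ∧ alphaDenom a b c ≠ 0 ∧ |alpha a b c| < 1 ∧
      ∀ m : ℤ, γ m 0 = alpha a b c ^ m.natAbs * σ ^ 2 / √(D a b c) := by
  have hst := h.two_mul_abs_lt hσ
  have hs : 1 + a ^ 2 - b ^ 2 - c ^ 2 ≠ 0 :=
    abs_pos.1 ((by positivity : 0 ≤ 2 * |a + b * c|).trans_lt hst)
  refine ⟨?_, root_denom_ne_zero hs, abs_root_lt_one hst, ?_⟩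
  · have hneg : -|1 + a ^ 2 - b ^ 2 - c ^ 2| < 2 * |a + b * c| :=
      (neg_neg_of_pos (abs_pos.2 hs)).trans_le (by positivity)
    have := sq_lt_sq' hneg hst
    rw [mul_pow, sq_abs, sq_abs] at this
    rw [D_eq]
    linarith
  · have hnat : ∀ m : ℕ, γ m 0 = alpha a b c ^ m * σ ^ 2 / √(D a b c) := by
      refine eq_root_pow_of_recurrence (g := fun m : ℕ => γ m 0) hst (D_eq a b c)
        (fun m => h.abs_autocov_le _ _) ?_ fun m => ?_
      · have h0 := h.row_recurrence hσ 0
        have h1 := h.neg 1 0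
        rw [neg_zero] at h1
        rw [if_pos rfl, zero_add, zero_sub, h1] at h0
        simp only [Nat.cast_zero, Nat.cast_one]
        linarith
      · have h0 := h.row_recurrence hσ (m + 1)
        rw [if_neg (by positivity), add_sub_cancel_right, add_assoc] at h0
        push_cast
        rw [show (m : ℤ) + 2 = m + (1 + 1) by norm_num]
        linarith
    intro m
    obtain ⟨k, rfl | rfl⟩ := m.eq_nat_or_neg
    · simpa using hnat k
    · have := h.neg k 0
      rw [neg_zero] at this
      rw [this, hnat k]
      simp

end Periodogram

end PlanarAR

/-! ### Embedding the random field in complex L² -/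

namespace PlanarAR

open MeasureTheory ProbabilityTheory

section Embedding

variable {Ω : Type*} [MeasurableSpace Ω] {μ : Measure Ω}

/-- A real square-integrable random variable as a vector of complex `L²`. -/
noncomputable def toL2 {f : Ω → ℝ} (hf : MemLp f 2 μ) : Lp ℂ 2 μ :=
  (hf.ofReal (K := ℂ)).toLp _

lemma coeFn_toL2 {f : Ω → ℝ} (hf : MemLp f 2 μ) :
    toL2 hf =ᵐ[μ] fun ω => ((f ω : ℝ) : ℂ) :=
  MemLp.coeFn_toLp _

lemma inner_toL2 {f g : Ω → ℝ} (hf : MemLp f 2 μ) (hg : MemLp g 2 μ) :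
    inner ℂ (toL2 hf) (toL2 hg) = ((∫ ω, f ω * g ω ∂μ : ℝ) : ℂ) := by
  rw [L2.inner_def, ← integral_complex_ofReal]
  refine integral_congr_ae ?_
  filter_upwards [coeFn_toL2 hf, coeFn_toL2 hg] with ω h1 h2
  rw [h1, h2]
  simp [mul_comm]

variable [IsProbabilityMeasure μ] {a b c σ : ℝ} {X ε : ℤ → ℤ → Ω → ℝ}

/-- This identity is exactly what lets the centred field satisfy the same equation; a + b + c ≠ 1 is
not yet needed. -/
lemma mean_eq_zero_of_solvesAR (hε : IsWhiteNoise μ ε σ) (hX : IsWideSenseStationary μ X)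
    (hAR : SolvesAR μ a b c X ε) :
    ∫ ω, X 0 0 ω ∂μ = (a + b + c) * ∫ ω, X 0 0 ω ∂μ := by
  have hi : ∀ i j, Integrable (X i j) μ := fun i j => (hX.memLp i j).integrable one_le_two
  have he : Integrable (ε 0 0) μ := (hε.memLp 0 0).integrable one_le_two
  have h1 := integral_congr_ae (hAR 0 0)
  have i1 : Integrable (fun ω => a * X (0 - 1) 0 ω + b * X 0 (0 - 1) ω) μ :=
    ((hi _ _).const_mul a).add ((hi _ _).const_mul b)
  have i2 : Integrable (fun ω => a * X (0 - 1) 0 ω + b * X 0 (0 - 1) ω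
      + c * X (0 - 1) (0 - 1) ω) μ := i1.add ((hi _ _).const_mul c)
  rw [integral_add i2 he, integral_add i1 ((hi _ _).const_mul c),
    integral_add ((hi _ _).const_mul a) ((hi _ _).const_mul b),
    integral_const_mul, integral_const_mul, integral_const_mul, hε.mean_zero, hX.mean_eq (0 - 1) 0,
    hX.mean_eq 0 (0 - 1), hX.mean_eq (0 - 1) (0 - 1)] at h1
  linarith

/-- The centred field and the noise form a planar autoregression in complex `L²`. -/
lemma exists_isHilbertAR (hσ : 0 ≤ σ) (hε : IsWhiteNoise μ ε σ)
    (hX : IsWideSenseStationary μ X) (hAR : SolvesAR μ a b c X ε) :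
    ∃ x e : ℤ → ℤ → Lp ℂ 2 μ, IsHilbertAR a b c σ x e (autocov μ X) := by
  have hm := mean_eq_zero_of_solvesAR hε hX hAR
  set m := ∫ ω, X 0 0 ω ∂μ with hmd
  have hc : ∀ i j, MemLp (fun ω => X i j ω - m) 2 μ := fun i j =>
    (hX.memLp i j).sub (memLp_const m)
  refine ⟨fun i j => toL2 (hc i j), fun i j => toL2 (hε.memLp i j), ?_, ?_, ?_, ?_⟩
  · intro i j k l
    rw [inner_toL2, ← hX.cov_eq i j (i - k) (j - l), sub_sub_cancel, sub_sub_cancel, covariance,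
      hX.mean_eq i j, hX.mean_eq k l]
  · intro i j
    refine Lp.ext ?_
    filter_upwards [Lp.coeFn_add ((a : ℂ) • toL2 (hc (i - 1) j) + (b : ℂ) • toL2 (hc i (j - 1))
        + (c : ℂ) • toL2 (hc (i - 1) (j - 1))) (toL2 (hε.memLp i j)),
      Lp.coeFn_add ((a : ℂ) • toL2 (hc (i - 1) j) + (b : ℂ) • toL2 (hc i (j - 1)))
        ((c : ℂ) • toL2 (hc (i - 1) (j - 1))),
      Lp.coeFn_add ((a : ℂ) • toL2 (hc (i - 1) j)) ((b : ℂ) • toL2 (hc i (j - 1))),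
      Lp.coeFn_smul (a : ℂ) (toL2 (hc (i - 1) j)), Lp.coeFn_smul (b : ℂ) (toL2 (hc i (j - 1))),
      Lp.coeFn_smul (c : ℂ) (toL2 (hc (i - 1) (j - 1))), coeFn_toL2 (hc i j),
      coeFn_toL2 (hc (i - 1) j), coeFn_toL2 (hc i (j - 1)), coeFn_toL2 (hc (i - 1) (j - 1)),
      coeFn_toL2 (hε.memLp i j), hAR i j] with ω h1 h2 h3 h4 h5 h6 h7 h8 h9 h10 h11 h12
    rw [h1, Pi.add_apply, h2, Pi.add_apply, h3, Pi.add_apply, h4, h5, h6, Pi.smul_apply,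
      Pi.smul_apply, Pi.smul_apply, h7, h8, h9, h10, h11, h12]
    simp only [smul_eq_mul]
    norm_cast
    linear_combination -hm
  · intro p q hpq
    have := hε.uncorrelated p.1 p.2 q.1 q.2 hpq
    rw [covariance] at this
    simp only [hε.mean_zero, sub_zero] at this
    rw [inner_toL2, this, Complex.ofReal_zero]
  · intro i j
    have h1 := hε.variance_eq i j
    rw [variance_eq_integral (hε.memLp i j).aemeasurable, hε.mean_zero] at h1
    simp only [sub_zero] at h1
    have h2 := inner_toL2 (hε.memLp i j) (hε.memLp i j)
    simp only [← sq, h1] at h2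
    rw [inner_self_eq_norm_sq_to_K] at h2
    rw [← sq_eq_sq₀ (norm_nonneg _) hσ]
    apply Complex.ofReal_injective
    rw [← h2]
    push_cast
    rfl

/-- Exchanging the two coordinates exchanges the roles of `a` and `b`. -/
lemma row_autocov_and_swap (hσ : 0 < σ) (hε : IsWhiteNoise μ ε σ)
    (hX : IsWideSenseStationary μ X) (hAR : SolvesAR μ a b c X ε) :
    0 < D b a c ∧ alphaDenom b a c ≠ 0 ∧ |alpha b a c| < 1 ∧
      ∀ m : ℤ, autocov μ X 0 m = alpha b a c ^ m.natAbs * σ ^ 2 / √(D b a c) := by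
  have hε' : IsWhiteNoise μ (fun i j => ε j i) σ :=
    ⟨fun i j => hε.memLp j i, fun i j => hε.mean_zero j i, fun i j => hε.variance_eq j i,
      fun i j k l h => hε.uncorrelated j i l k fun h' => h (by simp_all)⟩
  have hX' : IsWideSenseStationary μ (fun i j => X j i) :=
    ⟨fun i j => hX.memLp j i, fun i j => hX.mean_eq j i, fun i j h₁ h₂ => hX.cov_eq j i h₂ h₁⟩
  have hAR' : SolvesAR μ b a c (fun i j => X j i) (fun i j => ε j i) := by
    intro i j
    filter_upwards [hAR j i] with ω h
    linarith
  obtain ⟨x, e, h⟩ := exists_isHilbertAR hσ.le hε' hX' hAR'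
  exact h.row_autocov hσ

end Embedding

lemma D_swap (a b c : ℝ) : D b a c = D a b c := by unfold D; ring

lemma alphaDenom_swap (a b c : ℝ) : alphaDenom b a c = betaDenom a b c := by
  have h : 1 + b ^ 2 - a ^ 2 - c ^ 2 = 1 - a ^ 2 + b ^ 2 - c ^ 2 := by ring
  rw [alphaDenom, betaDenom, D_swap, h]

lemma alpha_swap (a b c : ℝ) : alpha b a c = beta a b c := by
  rw [alpha, beta, alphaDenom_swap, add_comm b]

end PlanarAR

/-! ### Both axes, the variance and the strict inequalities -/

theorem mainTheorem6 {Ω : Type*} [MeasurableSpace Ω] (μ : MeasureTheory.Measure Ω)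
    [MeasureTheory.IsProbabilityMeasure μ] (a b c σ : ℝ) (hσ : 0 < σ)
    (X ε : ℤ → ℤ → Ω → ℝ)
    (hε : PlanarAR.IsWhiteNoise μ ε σ)
    (hX : PlanarAR.IsWideSenseStationary μ X)
    (hAR : PlanarAR.SolvesAR μ a b c X ε) :
    0 < PlanarAR.D a b c ∧
    PlanarAR.alphaDenom a b c ≠ 0 ∧
    PlanarAR.betaDenom a b c ≠ 0 ∧
    (∀ h₂ : ℤ, PlanarAR.autocov μ X 0 h₂ =
      PlanarAR.beta a b c ^ h₂.natAbs * σ ^ 2 / √(PlanarAR.D a b c)) ∧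
    (∀ h₁ : ℤ, PlanarAR.autocov μ X h₁ 0 =
      PlanarAR.alpha a b c ^ h₁.natAbs * σ ^ 2 / √(PlanarAR.D a b c)) ∧
    (∀ i j : ℤ, ProbabilityTheory.variance (X i j) μ = σ ^ 2 / √(PlanarAR.D a b c)) ∧
    |PlanarAR.alpha a b c| < 1 ∧
    |PlanarAR.beta a b c| < 1 ∧
    |PlanarAR.autocov μ X 1 0| < PlanarAR.autocov μ X 0 0 ∧
    |PlanarAR.autocov μ X 0 1| < PlanarAR.autocov μ X 0 0 := by
  obtain ⟨x, e, h⟩ := PlanarAR.exists_isHilbertAR hσ.le hε hX hAR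
  obtain ⟨hD, hα, hα1, hrow⟩ := h.row_autocov hσ
  obtain ⟨-, hβ, hβ1, hcol⟩ := PlanarAR.row_autocov_and_swap hσ hε hX hAR
  rw [PlanarAR.alphaDenom_swap] at hβ
  rw [PlanarAR.alpha_swap] at hβ1
  rw [PlanarAR.alpha_swap, PlanarAR.D_swap] at hcol
  have h0 : PlanarAR.autocov μ X 0 0 = σ ^ 2 / √(PlanarAR.D a b c) := by
    simpa using hrow 0
  have hv : 0 < σ ^ 2 / √(PlanarAR.D a b c) := by positivity
  have hlt : ∀ r : ℝ, |r| < 1 →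
      |r ^ (1 : ℤ).natAbs * σ ^ 2 / √(PlanarAR.D a b c)| < σ ^ 2 / √(PlanarAR.D a b c) := by
    intro r hr
    rw [Int.natAbs_one, pow_one, mul_div_assoc, abs_mul, abs_of_pos hv]
    exact mul_lt_of_lt_one_left hv hr
  refine ⟨hD, hα, hβ, hcol, hrow, fun i j => ?_, hα1, hβ1, ?_, ?_⟩
  · have h1 := hX.cov_eq i j 0 0
    rw [sub_zero, sub_zero, ProbabilityTheory.covariance_self (hX.memLp i j).aemeasurable] at h1
    rw [h1, h0]
  · rw [hrow 1, h0]
    exact hlt _ hα1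
  · rw [hcol 1, h0]
    exact hlt _ hβ1
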